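/- Let $p<q$ be positive integers and let $d>0$ be a real number such that $pd$ and $qd$ are integers (for example a positive integer $d$). Let $n>m>1$ be integers with $np=mq$ and $d\le \frac{m+3}{3(p+q)}$. Start with the bipartite graph with left vertex set $L$, $|L|=n$, right vertex set $R$, $|R|=m$, and no edges, and add $npd=mqd$ edges one by one. Let $\deg$ and $\delta$ denote degree and distance in the current graph ($\delta=\infty$ if there is no path). When the $e$-th edge is added, put $i=\lceil e/n\rceil$, $j=\lceil e/m\rceil$. If $e$ is odd, choose a vertex $x\in L$ of minimum degree in $L$, let $S=\{z\in R:\delta(x,z)>1,\ \deg(z)<j+1\}$, choose $y\in S$ with $\delta(x,y)$ maximal, and add the edge $xy$. If $e$ is even, choose a vertex $x\in R$ of minimum degree in $R$, let $S=\{z\in L:\delta(x,z)>1,\ \deg(z)<i+1\}$, choose $y\in S$ with $\delta(x,y)$ maximal, and add the edge $xy$. Ties are broken arbitrarily. Then the algorithm never gets stuck ($S$ is never empty before all $npd$ edges have been added), and, whatever choices are made, the girth $g(G)$ of the resulting graph $G$ (with $g(G)=\infty$ if $G$ has no cycle) satisfies $$g(G)\ \ge\ 2\log_{pqd^2}\left(1+\frac{m(pqd^2-1)}{2(pd+1)}\right).$$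 Consequently $g(G)=\Omega(\log n)$: for fixed $p,q,d$ there is a constant $c>0$ such that $g(G)\ge c\log n$ for all $m,n$ as above and all graphs $G$ that the algorithm can produce. -/

import Mathlib

open scoped ENNReal

namespace GreedyTanner

/-- The bipartite graph with left vertices `1..n` (here `Sum.inl x`), right vertices `1..m`
(here `Sum.inr y`) and edge set `E ⊆ L × R`. -/
def tannerGraph {n m : ℕ} (E : Finset (Fin n × Fin m)) : SimpleGraph (Fin n ⊕ Fin m) where
  Adj
    | Sum.inl x, Sum.inr y => (x, y) ∈ E
    | Sum.inr y, Sum.inl x => (x, y) ∈ E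
    | Sum.inl _, Sum.inl _ => False
    | Sum.inr _, Sum.inr _ => False
  symm := ⟨by rintro (x | y) (x' | y') h <;> exact h⟩
  loopless := ⟨by rintro (x | y) h <;> exact h⟩

instance {n m : ℕ} (E : Finset (Fin n × Fin m)) : DecidableRel (tannerGraph E).Adj
  | Sum.inl x, Sum.inr y => inferInstanceAs (Decidable ((x, y) ∈ E))
  | Sum.inr y, Sum.inl x => inferInstanceAs (Decidable ((x, y) ∈ E))
  | Sum.inl _, Sum.inl _ => inferInstanceAs (Decidable False)
  | Sum.inr _, Sum.inr _ => inferInstanceAs (Decidable False)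

/-- The degree of the left vertex `x`. -/
def degL {n m : ℕ} (E : Finset (Fin n × Fin m)) (x : Fin n) : ℕ :=
  (tannerGraph E).degree (Sum.inl x)

/-- The degree of the right vertex `y`. -/
def degR {n m : ℕ} (E : Finset (Fin n × Fin m)) (y : Fin m) : ℕ :=
  (tannerGraph E).degree (Sum.inr y)

/-- The distance between the left vertex `x` and the right vertex `y`
(it is `⊤` if there is no path between them). -/
noncomputable def dist {n m : ℕ} (E : Finset (Fin n × Fin m)) (x : Fin n) (y : Fin m) : ℕ∞ :=
  (tannerGraph E).edist (Sum.inl x) (Sum.inr y)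

/-- The right vertices that may be joined to the left vertex `x` by the `e`-th edge;
`e ⌈/⌉ m` is the index `⌈e / m⌉` of the right phase. -/
def candR {n m : ℕ} (e : ℕ) (E : Finset (Fin n × Fin m)) (x : Fin n) : Set (Fin m) :=
  {z | 1 < dist E x z ∧ degR E z < e ⌈/⌉ m + 1}

/-- The left vertices that may be joined to the right vertex `x` by the `e`-th edge;
`e ⌈/⌉ n` is the index `⌈e / n⌉` of the left phase. -/
def candL {n m : ℕ} (e : ℕ) (E : Finset (Fin n × Fin m)) (x : Fin m) : Set (Fin n) :=
  {z | 1 < dist E z x ∧ degL E z < e ⌈/⌉ n + 1}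

/-- `E'` may arise from `E` by adding an edge from a left vertex of minimum degree to a farthest
admissible right vertex (the rule for odd `e`). -/
def OddStep {n m : ℕ} (e : ℕ) (E E' : Finset (Fin n × Fin m)) : Prop :=
  ∃ x : Fin n, (∀ x' : Fin n, degL E x ≤ degL E x') ∧
    ∃ y ∈ candR e E x, (∀ z ∈ candR e E x, dist E x z ≤ dist E x y) ∧ E' = insert (x, y) E

/-- `E'` may arise from `E` by adding an edge from a right vertex of minimum degree to a farthest
admissible left vertex (the rule for even `e`). -/
def EvenStep {n m : ℕ} (e : ℕ) (E E' : Finset (Fin n × Fin m)) : Prop :=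
  ∃ x : Fin m, (∀ x' : Fin m, degR E x ≤ degR E x') ∧
    ∃ y ∈ candL e E x, (∀ z ∈ candL e E x, dist E z x ≤ dist E y x) ∧ E' = insert (y, x) E

/-- The algorithm may go from `E` to `E'` when it adds the `e`-th edge. -/
def Step {n m : ℕ} (e : ℕ) (E E' : Finset (Fin n × Fin m)) : Prop :=
  (Odd e ∧ OddStep e E E') ∨ (Even e ∧ EvenStep e E E')

/-- `Reaches e E`: some run of the algorithm, with some way of breaking ties, has edge set `E`
after its first `e` edges have been added. -/
inductive Reaches {n m : ℕ} : ℕ → Finset (Fin n × Fin m) → Prop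
  | start : Reaches 0 ∅
  | next {e : ℕ} {E E' : Finset (Fin n × Fin m)} :
      Reaches e E → Step (e + 1) E E' → Reaches (e + 1) E'

/-- Every run that has added fewer than `N` edges can add another one, whatever its choices
were. -/
def NeverStuck (n m N : ℕ) : Prop :=
  ∀ e < N, ∀ E : Finset (Fin n × Fin m), Reaches e E → ∃ E', Step (e + 1) E E'

/-- The girth of the graph with edge set `E`, as an extended real number
(it is `⊤` if the graph has no cycle). -/
noncomputable def girth {n m : ℕ} (E : Finset (Fin n × Fin m)) : EReal :=
  (((tannerGraph E).egirth : ℝ≥0∞) : EReal)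

/-- The standing assumptions on the sizes `m`, `n` for given `p`, `q`, `d`. -/
structure Admissible (p q : ℕ) (d : ℝ) (m n : ℕ) : Prop where
  one_lt : 1 < m
  lt : m < n
  balance : n * p = m * q
  d_le : d ≤ ((m : ℝ) + 3) / (3 * ((p : ℝ) + q))

end GreedyTanner

namespace SimpleGraph

variable {V : Type*} {G : SimpleGraph V}

/-! Put `a = pd`, `b = qd`. On a vertex class of size N, let j be the integer part of e/N and call a
vertex high if its degree is at least j + 2. A vertex of minimum degree has degree at most j by
averaging, so a step starting in the class creates no high vertex; a step ending in it creates at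
most one, and such steps alternate with the others. Hence, just before a step ending in the class,
more than half of its vertices are low (`Balanced`).

All low non-neighbours of the start x are candidates. There are too many low vertices for all of
them to be neighbours of x, so the algorithm never gets stuck. If the new edge xy closes a cycle of
length ℓ, then ℓ is at least δ(x,y) + 1 = 2k + 2, and since y is a farthest candidate, every low
vertex lies within distance 2k + 1 of x. Degrees are at most `a + 1` and `b + 1`, so counting layers
around x bounds the number of low vertices by a geometric sum in `a * b`, which forces k to be
logarithmically large. -/

lemma exists_adj_edist_eq {x v : V} {k : ℕ} (h : G.edist x v = (k + 1 : ℕ)) :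
    ∃ u, G.Adj u v ∧ G.edist x u = k := by
  obtain ⟨w, hw⟩ := exists_walk_of_edist_eq_coe h
  have hnil : ¬ w.Nil := by
    intro hn
    have := Walk.length_eq_zero_iff.mpr hn
    omega
  refine ⟨w.penultimate, w.adj_penultimate hnil, le_antisymm ?_ ?_⟩
  · refine (edist_le w.dropLast).trans ?_
    simp [hw]
  · have h1 := G.edist_triangle (u := x) (v := w.penultimate) (w := v)
    rw [h, edist_eq_one_iff_adj.mpr (w.adj_penultimate hnil)] at h1
    push_cast at h1
    exact (ENat.add_le_add_iff_right ENat.one_ne_top).mp h1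

lemma Coloring.even_iff_of_edist_eq (c : G.Coloring Bool) {x v : V} {k : ℕ}
    (h : G.edist x v = k) : Even k ↔ c x = c v := by
  obtain ⟨w, hw⟩ := exists_walk_of_edist_eq_coe h
  rw [← hw, c.even_length_iff_congr w, ← Bool.eq_iff_iff]

/-! ### Counting vertices by distance -/

section Layers

variable [Fintype V]

open Classical in
/-- The set of vertices at distance exactly `k` from `x`. -/
noncomputable def layer (G : SimpleGraph V) (x : V) (k : ℕ) : Finset V :=
  Finset.univ.filter fun v => G.edist x v = k

@[simp] lemma mem_layer {x v : V} {k : ℕ} : v ∈ G.layer x k ↔ G.edist x v = k := by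
  simp [layer]

variable [DecidableRel G.Adj]

lemma card_layer_one (x : V) : (G.layer x 1).card = G.degree x := by
  rw [← card_neighborFinset_eq_degree]
  congr 1
  ext v
  simp

/-- Each vertex of layer `k + 1` spends one of its at most `D + 1` edges on a neighbour in layer
`k`. -/
lemma card_layer_add_two_le {x : V} {k D : ℕ}
    (hD : ∀ v ∈ G.layer x (k + 1), G.degree v ≤ D + 1) :
    (G.layer x (k + 2)).card ≤ (G.layer x (k + 1)).card * D := by
  classical
  have hsub : G.layer x (k + 2) ⊆ (G.layer x (k + 1)).biUnion
      fun v => (G.neighborFinset v).filter (· ∈ G.layer x (k + 2)) := by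
    intro w hw
    obtain ⟨v, hvw, hv⟩ := exists_adj_edist_eq (mem_layer.mp hw)
    simp only [Finset.mem_biUnion, Finset.mem_filter, mem_neighborFinset]
    exact ⟨v, mem_layer.mpr hv, hvw, hw⟩
  refine (Finset.card_le_card hsub).trans (Finset.card_biUnion_le_card_mul _ _ _ ?_)
  intro v hv
  obtain ⟨u, huv, hu⟩ := exists_adj_edist_eq (mem_layer.mp hv)
  have hsub' : (G.neighborFinset v).filter (· ∈ G.layer x (k + 2)) ⊆
      (G.neighborFinset v).erase u := by
    intro w hw
    simp only [Finset.mem_filter, mem_layer, Finset.mem_erase] at hw ⊢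
    refine ⟨?_, hw.1⟩
    rintro rfl
    have := hw.2.symm.trans hu
    norm_cast at this
    omega
  have hle := Finset.card_le_card hsub'
  rw [Finset.card_erase_of_mem (by simpa using huv.symm), card_neighborFinset_eq_degree] at hle
  have := hD v hv
  omega

/-- In a bipartite graph whose degrees are at most `α + 1` on the side of `x` and at most `β + 1`
on the other side, at most `(α + 1) ∑ (αβ) ^ i` vertices of the other side are within distance
`2k + 1` of `x`. -/
lemma Coloring.card_odd_ball_le (c : G.Coloring Bool) (x : V) {α β : ℕ}
    (hα : ∀ v, c v = c x → G.degree v ≤ α + 1) (hβ : ∀ v, c v ≠ c x → G.degree v ≤ β + 1)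
    (k : ℕ) (s : Finset V) (hs : ∀ v ∈ s, c v ≠ c x ∧ G.edist x v ≤ (2 * k + 1 : ℕ)) :
    s.card ≤ (α + 1) * ∑ i ∈ Finset.range (k + 1), (α * β) ^ i := by
  classical
  have hlayer : ∀ i, (G.layer x (2 * i + 1)).card ≤ (α + 1) * (α * β) ^ i := by
    intro i
    induction i with
    | zero => simpa [card_layer_one] using hα x rfl
    | succ i ih =>
      have h1 : (G.layer x (2 * i + 2)).card ≤ (G.layer x (2 * i + 1)).card * β := by
        refine card_layer_add_two_le fun v hv => hβ v fun hc => ?_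
        have := (c.even_iff_of_edist_eq (mem_layer.mp hv)).mpr hc.symm
        exact absurd this (by simp)
      have h2 : (G.layer x (2 * i + 1 + 2)).card ≤ (G.layer x (2 * i + 1 + 1)).card * α := by
        refine card_layer_add_two_le fun v hv => hα v ?_
        exact ((c.even_iff_of_edist_eq (mem_layer.mp hv)).mp (by simp [parity_simps])).symm
      calc (G.layer x (2 * (i + 1) + 1)).card ≤ (G.layer x (2 * i + 1)).card * β * α :=
            h2.trans (Nat.mul_le_mul_right _ h1)
        _ ≤ (α + 1) * (α * β) ^ i * β * α := by gcongr
        _ = (α + 1) * (α * β) ^ (i + 1) := by ring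
  have hsub : s ⊆ (Finset.range (k + 1)).biUnion fun i => G.layer x (2 * i + 1) := by
    intro v hv
    obtain ⟨hc, hd⟩ := hs v hv
    obtain ⟨l, hl⟩ := ENat.ne_top_iff_exists.mp (ne_top_of_le_ne_top (ENat.natCast_ne_top _) hd)
    rw [← hl] at hd
    have hodd : ¬ Even l := fun he => hc ((c.even_iff_of_edist_eq hl.symm).mp he).symm
    obtain ⟨i, rfl⟩ := Nat.not_even_iff_odd.mp hodd
    have : 2 * i + 1 ≤ 2 * k + 1 := by exact_mod_cast hd
    simp only [Finset.mem_biUnion, Finset.mem_range, mem_layer]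
    exact ⟨i, by omega, hl.symm⟩
  calc s.card ≤ ∑ i ∈ Finset.range (k + 1), (G.layer x (2 * i + 1)).card :=
        (Finset.card_le_card hsub).trans Finset.card_biUnion_le
    _ ≤ ∑ i ∈ Finset.range (k + 1), (α + 1) * (α * β) ^ i := Finset.sum_le_sum fun i _ => hlayer i
    _ = _ := by rw [Finset.mul_sum]

end Layers

/-! ### Cycles through a new edge -/

section NewEdge

variable {G' : SimpleGraph V} {x y : V}

/-- A cycle does not repeat its first edge, so the rest of it is a walk from `y` to `x` in `G`. -/
lemma edist_add_one_le_length_of_snd_eq (hG : ∀ u v, G'.Adj u v → G.Adj u v ∨ s(u, v) = s(x, y))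
    {w : G'.Walk x x} (hw : w.IsCycle) (hsnd : w.snd = y) : G.edist x y + 1 ≤ w.length := by
  cases w with
  | nil => exact absurd hw Walk.not_isCycle_nil
  | cons h p =>
    simp only [Walk.snd_cons] at hsnd
    subst hsnd
    obtain ⟨-, hp⟩ := (Walk.cons_isCycle_iff p h).mp hw
    have hmem : ∀ e ∈ p.edges, e ∈ G.edgeSet := by
      intro e he
      induction e with
      | h u v =>
        refine (hG u v (p.adj_of_mem_edges he)).resolve_right fun heq => hp ?_
        rwa [← heq]
    have := edist_le (p.transfer G hmem)
    rw [Walk.length_transfer, edist_comm] at this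
    rw [Walk.length_cons, Nat.cast_add, Nat.cast_one]
    gcongr

/-- A cycle created by adding the edge `xy` is longer than the distance between `x` and `y`
before the addition. -/
lemma edist_add_one_le_length_of_mem_edges
    (hG : ∀ u v, G'.Adj u v → G.Adj u v ∨ s(u, v) = s(x, y))
    {u : V} {w : G'.Walk u u} (hw : w.IsCycle) (he : s(x, y) ∈ w.edges) :
    G.edist x y + 1 ≤ w.length := by
  classical
  have hx := w.fst_mem_support_of_mem_edges he
  have hrot := hw.rotate hx
  have he' : s(x, y) ∈ (w.rotate x hx).edges := (w.rotate_edges x hx).perm.mem_iff.mpr he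
  rw [← w.length_rotate x hx]
  generalize w.rotate x hx = c at hrot he'
  -- Based at `x`, the cycle has `xy` as its first or its last edge; reversal reduces the second
  -- case to the first.
  by_cases hsnd : c.snd = y
  · exact edist_add_one_le_length_of_snd_eq hG hrot hsnd
  · rw [← Walk.length_reverse]
    refine edist_add_one_le_length_of_snd_eq hG hrot.reverse ?_
    rw [Walk.snd_reverse]
    cases c with
    | nil => simp at he'
    | cons h p =>
      have hp := ((Walk.cons_isCycle_iff p h).mp hrot).1
      simp only [Walk.snd_cons] at hsnd
      rw [Walk.edges_cons, List.mem_cons] at he'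
      rcases he' with he' | he'
      · exact absurd (Sym2.congr_right.mp he').symm hsnd
      · have hnil : ¬ p.Nil := Walk.not_nil_of_isCycle_cons hrot
        rw [Walk.penultimate_cons_of_not_nil _ _ hnil]
        exact (hp.eq_penultimate_of_mem_edges (Sym2.eq_swap ▸ he')).symm

lemma exists_isCycle_of_notMem_edges
    (hG : ∀ u v, G'.Adj u v → G.Adj u v ∨ s(u, v) = s(x, y))
    {u : V} {w : G'.Walk u u} (hw : w.IsCycle) (he : s(x, y) ∉ w.edges) :
    ∃ w' : G.Walk u u, w'.IsCycle ∧ w'.length = w.length := by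
  have hmem : ∀ e ∈ w.edges, e ∈ G.edgeSet := by
    intro e hew
    induction e with
    | h u v =>
      refine (hG u v (w.adj_of_mem_edges hew)).resolve_right fun heq => he ?_
      rwa [← heq]
  exact ⟨w.transfer G hmem, hw.transfer hmem, w.length_transfer hmem⟩

end NewEdge

end SimpleGraph

/-! ### Balance of the degree sequences -/

namespace GreedyTanner

/-- The degree sequence `f` on a vertex class after `e` edges: the degrees sum to `e`, they exceed
the phase index `j` by at most one, and the vertices with degree above the phase index have been
created by the steps of parity `r` of the current phase. -/
structure Balanced {V : Type*} [Fintype V] (r e : ℕ) (f : V → ℕ) : Prop where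
  sum_eq : ∑ v, f v = e
  le : ∀ j, e ≤ j * Fintype.card V → ∀ v, f v ≤ j + 1
  card_le : ∀ j, j * Fintype.card V ≤ e → e ≤ (j + 1) * Fintype.card V →
    (Finset.univ.filter fun v => j + 2 ≤ f v).card ≤ (e + r) / 2 - (j * Fintype.card V + r) / 2

namespace Balanced

variable {V : Type*} [Fintype V] {r e : ℕ} {f : V → ℕ}

lemma zero (r : ℕ) : Balanced r 0 (fun _ : V => 0) where
  sum_eq := by simp
  le := by simp
  card_le := by simp

lemma le_of_minimal (h : Balanced r e f) {v : V} (hv : ∀ w, f v ≤ f w) {j : ℕ}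
    (he : e < (j + 1) * Fintype.card V) : f v ≤ j := by
  have h1 : Fintype.card V * f v ≤ e := by
    rw [← h.sum_eq, ← smul_eq_mul, ← Finset.card_univ]
    exact Finset.card_nsmul_le_sum _ _ _ fun w _ => hv w
  have h2 : Fintype.card V * f v < Fintype.card V * (j + 1) := by
    rw [mul_comm _ (j + 1)]
    omega
  have := lt_of_mul_lt_mul_left h2 (Nat.zero_le _)
  omega

lemma card_high_le (h : Balanced r e f) {j : ℕ} (hj : j * Fintype.card V ≤ e)
    (he : e < (j + 1) * Fintype.card V) :
    (Finset.univ.filter fun v => j + 2 ≤ f v).card ≤ (e + r) / 2 - (j * Fintype.card V + r) / 2 :=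
  h.card_le j hj he.le

/-- Before a step of parity `r`, more than half of the vertices are not above the phase index. -/
lemma card_lt_two_mul_card_low (h : Balanced r e f) {j : ℕ} (hj : j * Fintype.card V ≤ e)
    (he : e < (j + 1) * Fintype.card V) (hr : Odd (e + r)) :
    Fintype.card V < 2 * (Finset.univ.filter fun v => f v < j + 2).card := by
  have h1 := h.card_high_le hj he
  have h2 := Finset.card_filter_add_card_filter_not (s := (Finset.univ : Finset V))
    (fun v => f v < j + 2)
  simp only [not_lt, Finset.card_univ] at h2
  -- The phase has at most ⌈|V|/2⌉ steps of parity `r`, and step `e + 1`, one of them, is still to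
  -- come; so fewer than half of the vertices are high.
  obtain ⟨t, ht⟩ := hr
  rw [add_mul, one_mul] at he
  generalize j * Fintype.card V = s at *
  omega

/-- If `e + r` is odd, `(e + r) / 2` grows by one and pays for `y` possibly becoming high. If `y`
has minimum degree, that degree is at most `j`, so `y` stays low. -/
lemma step [DecidableEq V] (h : Balanced r e f) {j : ℕ} (hj : j * Fintype.card V ≤ e)
    (he : e < (j + 1) * Fintype.card V) {y : V}
    (hy : (Odd (e + r) ∧ f y < j + 2) ∨ ∀ w, f y ≤ f w) :
    Balanced r (e + 1) (fun v => f v + if v = y then 1 else 0) := by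
  have hV : 0 < Fintype.card V := Fintype.card_pos_iff.mpr ⟨y⟩
  have hfy : f y ≤ j + 1 := by
    rcases hy with hy | hy
    · omega
    · exact (h.le_of_minimal hy he).trans (Nat.le_succ j)
  have hmax : ∀ v, (f v + if v = y then 1 else 0) ≤ j + 2 := by
    intro v
    split_ifs with hv
    · subst hv; omega
    · exact h.le (j + 1) he.le v
  have hcard : (Finset.univ.filter fun v => j + 2 ≤ f v + if v = y then 1 else 0).card
      ≤ (e + 1 + r) / 2 - (j * Fintype.card V + r) / 2 := by
    have h1 := h.card_high_le hj he
    rcases hy with ⟨⟨t, ht⟩, hy⟩ | hy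
    · have hsub : (Finset.univ.filter fun v => j + 2 ≤ f v + if v = y then 1 else 0) ⊆
          insert y (Finset.univ.filter fun v => j + 2 ≤ f v) := by
        intro v hv
        by_cases hvy : v = y
        · simp [hvy]
        · simpa [hvy] using hv
      have := (Finset.card_le_card hsub).trans (Finset.card_insert_le _ _)
      omega
    · have hle := h.le_of_minimal hy he
      have hsub : (Finset.univ.filter fun v => j + 2 ≤ f v + if v = y then 1 else 0) ⊆
          Finset.univ.filter fun v => j + 2 ≤ f v := by
        intro v hv
        by_cases hvy : v = y
        · subst hvy
          simp only [Finset.mem_filter, Finset.mem_univ, true_and, if_true] at hv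
          omega
        · simpa [hvy] using hv
      have := Finset.card_le_card hsub
      omega
  have hle : ∀ i, e + 1 ≤ i * Fintype.card V →
      ∀ v, (f v + if v = y then 1 else 0) ≤ i + 1 := by
    intro i hi v
    have : j * Fintype.card V < i * Fintype.card V := by omega
    have := lt_of_mul_lt_mul_right this (Nat.zero_le _)
    exact (hmax v).trans (by omega)
  refine ⟨?_, hle, ?_⟩
  · rw [Finset.sum_add_distrib, h.sum_eq]
    simp
  · intro i hi hi'
    -- At a phase boundary `e + 1 = i * |V|` the allowance is 0, and the maximum degree bound `i +
    -- 1` excludes high vertices.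
    rcases hi.eq_or_lt with heq | hlt
    · rw [Finset.filter_false_of_mem]
      · simp
      · intro v _
        have := hle i heq.ge v
        omega
    · have h1 : i * Fintype.card V < (j + 1) * Fintype.card V := by omega
      have h2 : j * Fintype.card V < (i + 1) * Fintype.card V := by omega
      have h1' := lt_of_mul_lt_mul_right h1 (Nat.zero_le _)
      have h2' := lt_of_mul_lt_mul_right h2 (Nat.zero_le _)
      obtain rfl : i = j := by omega
      exact hcard

end Balanced

/-! ### Degrees, sides and adjacency in the Tanner graph -/

variable {n m : ℕ} {E : Finset (Fin n × Fin m)}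

lemma tannerGraph_adj_inl_inr {x : Fin n} {y : Fin m} :
    (tannerGraph E).Adj (Sum.inl x) (Sum.inr y) ↔ (x, y) ∈ E := Iff.rfl

lemma tannerGraph_adj_inr_inl {x : Fin n} {y : Fin m} :
    (tannerGraph E).Adj (Sum.inr y) (Sum.inl x) ↔ (x, y) ∈ E := Iff.rfl

lemma tannerGraph_not_adj_inl_inl {x x' : Fin n} :
    ¬ (tannerGraph E).Adj (Sum.inl x) (Sum.inl x') := id

lemma tannerGraph_not_adj_inr_inr {y y' : Fin m} :
    ¬ (tannerGraph E).Adj (Sum.inr y) (Sum.inr y') := id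

lemma degL_eq_card (E : Finset (Fin n × Fin m)) (x : Fin n) :
    degL E x = (E.filter fun z => z.1 = x).card := by
  rw [degL, ← SimpleGraph.card_neighborFinset_eq_degree]
  symm
  refine Finset.card_bij (fun z _ => Sum.inr z.2) ?_ ?_ ?_
  · rintro ⟨u, v⟩ h
    simp only [Finset.mem_filter] at h
    obtain ⟨h, rfl⟩ := h
    simpa [tannerGraph_adj_inl_inr] using h
  · rintro ⟨u, v⟩ h ⟨u', v'⟩ h' heq
    simp_all
  · rintro (u | v) h
    · simp [tannerGraph_not_adj_inl_inl] at h
    · exact ⟨(x, v), by simpa [tannerGraph_adj_inl_inr] using h, rfl⟩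

lemma degR_eq_card (E : Finset (Fin n × Fin m)) (y : Fin m) :
    degR E y = (E.filter fun z => z.2 = y).card := by
  rw [degR, ← SimpleGraph.card_neighborFinset_eq_degree]
  symm
  refine Finset.card_bij (fun z _ => Sum.inl z.1) ?_ ?_ ?_
  · rintro ⟨u, v⟩ h
    simp only [Finset.mem_filter] at h
    obtain ⟨h, rfl⟩ := h
    simpa [tannerGraph_adj_inr_inl] using h
  · rintro ⟨u, v⟩ h ⟨u', v'⟩ h' heq
    simp_all
  · rintro (u | v) h
    · exact ⟨(u, y), by simpa [tannerGraph_adj_inr_inl] using h, rfl⟩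
    · simp [tannerGraph_not_adj_inr_inr] at h

lemma degL_insert {x : Fin n} {y : Fin m} (h : (x, y) ∉ E) :
    degL (insert (x, y) E) = fun v => degL E v + if v = x then 1 else 0 := by
  funext v
  rw [degL_eq_card, degL_eq_card, Finset.filter_insert]
  by_cases hv : x = v
  · subst hv
    simp [h]
  · simp [hv, Ne.symm hv]

lemma degR_insert {x : Fin n} {y : Fin m} (h : (x, y) ∉ E) :
    degR (insert (x, y) E) = fun v => degR E v + if v = y then 1 else 0 := by
  funext v
  rw [degR_eq_card, degR_eq_card, Finset.filter_insert]
  by_cases hv : y = v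
  · subst hv
    simp [h]
  · simp [hv, Ne.symm hv]

/-- The colouring of the vertices by the two sides. -/
def sideColoring (E : Finset (Fin n × Fin m)) : (tannerGraph E).Coloring Bool :=
  SimpleGraph.Coloring.mk Sum.isLeft (by rintro (u | u) (v | v) h <;> first | exact h.elim | simp)

@[simp] lemma sideColoring_inl (x : Fin n) : sideColoring E (Sum.inl x) = true := rfl

@[simp] lemma sideColoring_inr (y : Fin m) : sideColoring E (Sum.inr y) = false := rfl

lemma adj_insert {x : Fin n} {y : Fin m} (u v : Fin n ⊕ Fin m)
    (h : (tannerGraph (insert (x, y) E)).Adj u v) :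
    (tannerGraph E).Adj u v ∨ s(u, v) = s(Sum.inl x, Sum.inr y) := by
  rcases u with u | u <;> rcases v with v | v
  · exact h.elim
  · rw [tannerGraph_adj_inl_inr, Finset.mem_insert] at h
    rcases h with h | h
    · right; simp_all
    · exact Or.inl h
  · rw [tannerGraph_adj_inr_inl, Finset.mem_insert] at h
    rcases h with h | h
    · right; simp_all
    · exact Or.inl h
  · exact h.elim

lemma notMem_of_one_lt_dist {x : Fin n} {y : Fin m} (h : 1 < dist E x y) : (x, y) ∉ E := by
  intro hxy
  rw [dist, SimpleGraph.edist_eq_one_iff_adj.mpr (tannerGraph_adj_inl_inr.mpr hxy)] at h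
  exact lt_irrefl _ h

lemma one_lt_dist_of_notMem {x : Fin n} {y : Fin m} (h : (x, y) ∉ E) : 1 < dist E x y := by
  rw [dist, ← not_le, SimpleGraph.edist_le_one_iff_adj_or_eq]
  simpa [tannerGraph_adj_inl_inr] using h

end GreedyTanner

/-! ### Runs of the algorithm: progress and girth -/

namespace GreedyTanner

variable {n m : ℕ}

lemma succ_ceilDiv {e k : ℕ} (hk : 0 < k) : (e + 1) ⌈/⌉ k = e / k + 1 := by
  rw [Nat.ceilDiv_eq_add_pred_div, ← Nat.add_div_right _ hk]
  congr 1
  omega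

lemma degL_empty : degL (∅ : Finset (Fin n × Fin m)) = fun _ => 0 := by
  funext x
  simp [degL_eq_card]

lemma degR_empty : degR (∅ : Finset (Fin n × Fin m)) = fun _ => 0 := by
  funext x
  simp [degR_eq_card]

lemma div_mul_card_le (e k : ℕ) : e / k * Fintype.card (Fin k) ≤ e := by
  rw [Fintype.card_fin]
  exact Nat.div_mul_le_self e k

lemma lt_div_succ_mul_card (e : ℕ) {k : ℕ} (hk : 0 < k) :
    e < (e / k + 1) * Fintype.card (Fin k) := by
  rw [Fintype.card_fin, mul_comm]
  exact Nat.lt_mul_div_succ e hk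

/-- The parity is that of the steps ending in the class: odd steps end in R, even steps in L. -/
lemma Reaches.balanced {e : ℕ} {E : Finset (Fin n × Fin m)} (h : Reaches e E) :
    Balanced 1 e (degR E) ∧ Balanced 0 e (degL E) := by
  induction h with
  | start =>
    rw [degL_empty, degR_empty]
    exact ⟨.zero 1, .zero 0⟩
  | @next e E E' _ hs ih =>
    obtain ⟨ihR, ihL⟩ := ih
    rcases hs with ⟨ho, x, hx, y, ⟨hd, hy⟩, -, rfl⟩ | ⟨he, x, hx, y, ⟨hd, hy⟩, -, rfl⟩
    · have hn := x.pos
      have hm := y.pos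
      have hE := notMem_of_one_lt_dist hd
      rw [succ_ceilDiv hm] at hy
      rw [degL_insert hE, degR_insert hE]
      exact ⟨ihR.step (div_mul_card_le e m) (lt_div_succ_mul_card e hm) (Or.inl ⟨ho, hy⟩),
        ihL.step (div_mul_card_le e n) (lt_div_succ_mul_card e hn) (Or.inr hx)⟩
    · have hm := x.pos
      have hn := y.pos
      have hE := notMem_of_one_lt_dist hd
      rw [succ_ceilDiv hn] at hy
      rw [degL_insert hE, degR_insert hE]
      refine ⟨ihR.step (div_mul_card_le e m) (lt_div_succ_mul_card e hm) (Or.inr hx),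
        ihL.step (div_mul_card_le e n) (lt_div_succ_mul_card e hn) (Or.inl ⟨?_, hy⟩)⟩
      rw [add_zero]
      exact Nat.not_even_iff_odd.mp (Nat.even_add_one.mp he)

lemma exists_oddStep {e a b : ℕ} {E : Finset (Fin n × Fin m)} (hn : 0 < n) (hm : 0 < m)
    (hE : Reaches e E) (hodd : Odd (e + 1)) (hea : e < n * a) (hab : a < b)
    (hsize : 3 * (a + b) ≤ m + 3) : ∃ E', OddStep (e + 1) E E' := by
  obtain ⟨hR, hL⟩ := hE.balanced
  have : Nonempty (Fin n) := ⟨⟨0, hn⟩⟩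
  obtain ⟨x, hx⟩ := Finite.exists_min (degL E)
  have hlow := hR.card_lt_two_mul_card_low (div_mul_card_le e m) (lt_div_succ_mul_card e hm) hodd
  have hdeg := hL.le_of_minimal hx (lt_div_succ_mul_card e hn)
  have hea' : e / n < a := Nat.div_lt_of_lt_mul hea
  have hne : (candR (e + 1) E x).Nonempty := by
    by_contra hempty
    rw [Set.not_nonempty_iff_eq_empty, Set.eq_empty_iff_forall_notMem] at hempty
    have : (Finset.univ.filter fun z => degR E z < e / m + 2).card ≤ degL E x := by
      rw [degL_eq_card]
      refine Finset.card_le_card_of_injOn (fun z => (x, z)) ?_ (by intro z _ z' _ h; simpa using h)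
      intro z hz
      simp only [Finset.coe_filter, Finset.mem_univ, true_and, Set.mem_ofPred_eq] at hz
      simp only [Finset.coe_filter, Set.mem_ofPred_eq, and_true]
      by_contra hxz
      refine hempty z ⟨one_lt_dist_of_notMem hxz, ?_⟩
      rwa [succ_ceilDiv hm]
    -- Fewer than `a` low vertices would give `m < 2 * a`, but `a < b` and `hsize` force `m ≥ 6 *
    -- a`.
    rw [Fintype.card_fin] at hlow
    omega
  obtain ⟨y, hy, hmax⟩ := Set.exists_max_image _ (dist E x) (Set.toFinite _) hne
  exact ⟨_, x, hx, y, hy, hmax, rfl⟩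

lemma exists_evenStep {e b : ℕ} {E : Finset (Fin n × Fin m)} (hn : 0 < n) (hm : 0 < m)
    (hE : Reaches e E) (heven : Even (e + 1)) (heb : e < m * b)
    (hsize : 3 * b ≤ n) : ∃ E', EvenStep (e + 1) E E' := by
  obtain ⟨hR, hL⟩ := hE.balanced
  have : Nonempty (Fin m) := ⟨⟨0, hm⟩⟩
  obtain ⟨x, hx⟩ := Finite.exists_min (degR E)
  have hlow := hL.card_lt_two_mul_card_low (div_mul_card_le e n) (lt_div_succ_mul_card e hn)
    (Nat.not_even_iff_odd.mp (Nat.even_add_one.mp heven))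
  have hdeg := hR.le_of_minimal hx (lt_div_succ_mul_card e hm)
  have heb' : e / m < b := Nat.div_lt_of_lt_mul heb
  have hne : (candL (e + 1) E x).Nonempty := by
    by_contra hempty
    rw [Set.not_nonempty_iff_eq_empty, Set.eq_empty_iff_forall_notMem] at hempty
    have : (Finset.univ.filter fun z => degL E z < e / n + 2).card ≤ degR E x := by
      rw [degR_eq_card]
      refine Finset.card_le_card_of_injOn (fun z => (z, x)) ?_ (by intro z _ z' _ h; simpa using h)
      intro z hz
      simp only [Finset.coe_filter, Finset.mem_univ, true_and, Set.mem_ofPred_eq] at hz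
      simp only [Finset.coe_filter, Set.mem_ofPred_eq, and_true]
      by_contra hxz
      refine hempty z ⟨one_lt_dist_of_notMem hxz, ?_⟩
      rwa [succ_ceilDiv hn]
    rw [Fintype.card_fin] at hlow
    omega
  obtain ⟨y, hy, hmax⟩ := Set.exists_max_image _ (fun z => dist E z x) (Set.toFinite _) hne
  exact ⟨_, x, hx, y, hy, hmax, rfl⟩

/-- The lower bound on the girth, for left degree `a` and right degree `b`. -/
noncomputable def girthBound (a b m : ℕ) : ℝ :=
  2 * Real.logb (a * b) (1 + m * (a * b - 1) / (2 * (a + 1)))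

/-- Summing the geometric series turns `h` into an upper bound `(a * b) ^ (k + 1)` for the argument
of the logarithm. -/
lemma girthBound_le {a b m k : ℕ} (hab : 2 ≤ a * b)
    (h : m < 2 * ((a + 1) * ∑ i ∈ Finset.range (k + 1), (a * b) ^ i)) :
    girthBound a b m ≤ 2 * k + 2 := by
  have hab' : (2 : ℝ) ≤ a * b := by exact_mod_cast hab
  have h' : (m : ℝ) ≤ 2 * ((a + 1) * ∑ i ∈ Finset.range (k + 1), ((a : ℝ) * b) ^ i) := by
    exact_mod_cast h.le
  have hgeom := geom_sum_mul ((a : ℝ) * b) (k + 1)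
  have hpow : 1 + (m : ℝ) * (a * b - 1) / (2 * (a + 1)) ≤ (a * b) ^ (k + 1) := by
    rw [← sub_add_cancel (((a : ℝ) * b) ^ (k + 1)) 1, ← hgeom, add_comm]
    gcongr
    rw [div_le_iff₀ (by positivity)]
    have := mul_le_mul_of_nonneg_right h' (by linarith : (0 : ℝ) ≤ a * b - 1)
    linarith
  have hpos : 0 < 1 + (m : ℝ) * (a * b - 1) / (2 * (a + 1)) := by
    have : (0 : ℝ) ≤ a * b - 1 := by linarith
    positivity
  have hlog : Real.logb (a * b) (1 + m * (a * b - 1) / (2 * (a + 1))) ≤ (k + 1 : ℕ) := by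
    rw [Real.logb_le_iff_le_rpow (by linarith) hpos, Real.rpow_natCast]
    exact hpow
  push_cast at hlog
  rw [girthBound]
  linarith

/-- Cycles created by joining `x` to a farthest vertex of a set `s` on the other side are long. -/
lemma exists_card_le_of_isCycle {V : Type*} [Fintype V] {G G' : SimpleGraph V}
    [DecidableRel G.Adj] (c : G.Coloring Bool) {x y : V} (hxy : c y ≠ c x)
    (hG : ∀ u v, G'.Adj u v → G.Adj u v ∨ s(u, v) = s(x, y)) {α β : ℕ}
    (hα : ∀ v, c v = c x → G.degree v ≤ α + 1) (hβ : ∀ v, c v ≠ c x → G.degree v ≤ β + 1)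
    (s : Finset V) (hs : ∀ v ∈ s, c v ≠ c x ∧ G.edist x v ≤ G.edist x y)
    {u : V} {w : G'.Walk u u} (hw : w.IsCycle) (he : s(x, y) ∈ w.edges) :
    ∃ k, 2 * k + 2 ≤ w.length ∧
      s.card ≤ (α + 1) * ∑ i ∈ Finset.range (k + 1), (α * β) ^ i := by
  have hlen := SimpleGraph.edist_add_one_le_length_of_mem_edges hG hw he
  have htop : G.edist x y ≠ ⊤ := by
    intro htop
    simp [htop] at hlen
  obtain ⟨l, hl⟩ := ENat.ne_top_iff_exists.mp htop
  have hodd : ¬ Even l := fun hl' => hxy ((c.even_iff_of_edist_eq hl.symm).mp hl').symm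
  obtain ⟨k, rfl⟩ := Nat.not_even_iff_odd.mp hodd
  rw [← hl] at hlen hs
  refine ⟨k, by exact_mod_cast hlen, ?_⟩
  exact c.card_odd_ball_le x hα hβ k s hs

lemma Reaches.degree_le {e a b : ℕ} {E : Finset (Fin n × Fin m)} (hE : Reaches e E)
    (hea : e ≤ n * a) (heb : e ≤ m * b) :
    (∀ x, (tannerGraph E).degree (Sum.inl x) ≤ a + 1) ∧
      ∀ y, (tannerGraph E).degree (Sum.inr y) ≤ b + 1 := by
  obtain ⟨hR, hL⟩ := hE.balanced
  exact ⟨hL.le a (by rwa [Fintype.card_fin, mul_comm]),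
    hR.le b (by rwa [Fintype.card_fin, mul_comm])⟩

/-- Induction on the run: a cycle avoiding the newest edge was there before, and one using it is
long by the farthest choice. -/
lemma Reaches.girthBound_le_length {e a b : ℕ} {E : Finset (Fin n × Fin m)} (hE : Reaches e E)
    (hab : a ≤ b) (hab2 : 2 ≤ a * b) (hbal : n * a = m * b) (hea : e ≤ n * a)
    {u : Fin n ⊕ Fin m} (w : (tannerGraph E).Walk u u) (hw : w.IsCycle) :
    girthBound a b m ≤ w.length := by
  induction hE generalizing u with
  | start =>
    have := w.adj_snd hw.not_nil
    revert this
    rcases u with u | u <;> generalize w.snd = v <;> rcases v with v | v <;> intro h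
    · exact h.elim
    · simp [tannerGraph_adj_inl_inr] at h
    · simp [tannerGraph_adj_inr_inl] at h
    · exact h.elim
  | @next e E E' hE hs ih =>
    obtain ⟨hR, hL⟩ := hE.balanced
    obtain ⟨hdL, hdR⟩ := hE.degree_le (a := a) (b := b) (by omega) (by omega)
    have hold : ∀ x y, E' = insert (x, y) E → s(Sum.inl x, Sum.inr y) ∉ w.edges →
        girthBound a b m ≤ w.length := by
      rintro x y rfl he
      obtain ⟨w', hw', hlen⟩ := SimpleGraph.exists_isCycle_of_notMem_edges adj_insert hw he
      rw [← hlen]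
      exact ih (by omega) w' hw'
    rcases hs with ⟨ho, x, hx, y, ⟨hd, hy⟩, hmax, rfl⟩ | ⟨he, x, hx, y, ⟨hd, hy⟩, hmax, rfl⟩
    · by_cases hmem : s(Sum.inl x, Sum.inr y) ∈ w.edges
      swap
      · exact hold x y rfl hmem
      have hm := y.pos
      have hlow := hR.card_lt_two_mul_card_low (div_mul_card_le e m)
        (lt_div_succ_mul_card e hm) ho
      obtain ⟨k, hk, hcard⟩ := exists_card_le_of_isCycle (sideColoring E) (α := a) (β := b)
        (x := Sum.inl x) (y := Sum.inr y) (by simp) adj_insert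
        (by rintro (v | v) h
            · exact hdL v
            · simp at h)
        (by rintro (v | v) h
            · simp at h
            · exact hdR v)
        ((Finset.univ.filter fun z => degR E z < e / m + 2).map Function.Embedding.inr)
        (by
          intro v hv
          simp only [Finset.mem_map, Finset.mem_filter, Finset.mem_univ, true_and] at hv
          obtain ⟨z, hz, rfl⟩ := hv
          refine ⟨by simp, ?_⟩
          -- Low neighbours of `x` are not candidates, but their distance 1 is harmless.
          by_cases hxz : (x, z) ∈ E
          · have : dist E x z = 1 :=
              SimpleGraph.edist_eq_one_iff_adj.mpr (tannerGraph_adj_inl_inr.mpr hxz)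
            exact this.le.trans hd.le
          · exact hmax z ⟨one_lt_dist_of_notMem hxz, by rwa [succ_ceilDiv hm]⟩)
        hw hmem
      rw [Finset.card_map] at hcard
      rw [Fintype.card_fin] at hlow
      refine (girthBound_le hab2 (k := k) (by omega)).trans ?_
      exact_mod_cast hk
    · by_cases hmem : s(Sum.inl y, Sum.inr x) ∈ w.edges
      swap
      · exact hold y x rfl hmem
      have hn := y.pos
      have hlow := hL.card_lt_two_mul_card_low (div_mul_card_le e n)
        (lt_div_succ_mul_card e hn) (Nat.not_even_iff_odd.mp (Nat.even_add_one.mp he))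
      obtain ⟨k, hk, hcard⟩ := exists_card_le_of_isCycle (sideColoring E) (α := b) (β := a)
        (x := Sum.inr x) (y := Sum.inl y) (by simp)
        (by
          intro u v h
          rw [Sym2.eq_swap (a := Sum.inr x)]
          exact adj_insert u v h)
        (by rintro (v | v) h
            · simp at h
            · exact hdR v)
        (by rintro (v | v) h
            · exact hdL v
            · simp at h)
        ((Finset.univ.filter fun z => degL E z < e / n + 2).map Function.Embedding.inl)
        (by
          intro v hv
          simp only [Finset.mem_map, Finset.mem_filter, Finset.mem_univ, true_and] at hv
          obtain ⟨z, hz, rfl⟩ := hv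
          refine ⟨by simp, ?_⟩
          rw [SimpleGraph.edist_comm, SimpleGraph.edist_comm (u := Sum.inr x)]
          by_cases hxz : (z, x) ∈ E
          · have : dist E z x = 1 :=
              SimpleGraph.edist_eq_one_iff_adj.mpr (tannerGraph_adj_inl_inr.mpr hxz)
            exact this.le.trans hd.le
          · exact hmax z ⟨one_lt_dist_of_notMem hxz, by rwa [succ_ceilDiv hn]⟩)
        hw (by rwa [Sym2.eq_swap])
      rw [Finset.card_map, mul_comm b a] at hcard
      rw [Fintype.card_fin] at hlow
      refine (girthBound_le hab2 (k := k) ?_).trans (by exact_mod_cast hk)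
      generalize ∑ i ∈ Finset.range (k + 1), (a * b) ^ i = S at hcard
      have hb : 0 < b := Nat.pos_of_ne_zero (by rintro rfl; simp at hab2)
      have ha : 0 < a := Nat.pos_of_ne_zero (by rintro rfl; simp at hab2)
      -- The count here bounds `n` with factor `b + 1`; since `n * a = m * b` and `(b + 1) * a ≤ (a
      -- + 1) * b`, it yields the bound on `m`.
      refine lt_of_mul_lt_mul_right (a := b) ?_ (Nat.zero_le _)
      calc m * b = n * a := hbal.symm
        _ < 2 * ((b + 1) * S) * a := Nat.mul_lt_mul_of_pos_right (by omega) ha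
        _ ≤ 2 * ((a + 1) * S) * b := by nlinarith [Nat.mul_le_mul_right S hab]

lemma le_girth_of_forall_isCycle {E : Finset (Fin n × Fin m)} {B : ℝ}
    (h : ∀ (u : Fin n ⊕ Fin m) (w : (tannerGraph E).Walk u u), w.IsCycle → B ≤ w.length) :
    (B : EReal) ≤ girth E := by
  rw [girth]
  by_cases hac : (tannerGraph E).IsAcyclic
  · simp [SimpleGraph.egirth_eq_top.mpr hac]
  · obtain ⟨u, w, hw, hlen⟩ := SimpleGraph.exists_egirth_eq_length.mpr hac
    rw [hlen]
    have := h u w hw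
    exact EReal.coe_le_coe_iff.mpr this

/-- With `m` proportional to `n` the argument is `1 + K * n`; Bernoulli's inequality with exponent
`min 1 K` bounds it below by a power of `n`, uniformly even when `K < 1`. -/
lemma mul_log_le_girthBound {a b : ℕ} (hab2 : 2 ≤ a * b) :
    ∃ c : ℝ, 0 < c ∧ ∀ m n : ℕ, 0 < n → n * a = m * b →
      c * Real.log n ≤ girthBound a b m := by
  have ha : 0 < a := Nat.pos_of_ne_zero (by rintro rfl; simp at hab2)
  have hb : 0 < b := Nat.pos_of_ne_zero (by rintro rfl; simp at hab2)
  have ha' : (0 : ℝ) < a := by exact_mod_cast ha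
  have hb' : (0 : ℝ) < b := by exact_mod_cast hb
  have hab' : (2 : ℝ) ≤ a * b := by exact_mod_cast hab2
  have hsub : (0 : ℝ) < a * b - 1 := by linarith
  have hlog : 0 < Real.log (a * b) := Real.log_pos (by linarith)
  obtain ⟨K, hKdef⟩ : ∃ K : ℝ, K = a * (a * b - 1) / (b * (2 * (a + 1))) := ⟨_, rfl⟩
  have hK : 0 < K := by rw [hKdef]; positivity
  refine ⟨2 * min 1 K / Real.log (a * b), by positivity, fun m n hn hbal => ?_⟩
  have hn' : (1 : ℝ) ≤ n := by exact_mod_cast hn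
  have hbal' : (n : ℝ) * a = m * b := by exact_mod_cast hbal
  have harg : (m : ℝ) * (a * b - 1) / (2 * (a + 1)) = K * n := by
    rw [hKdef]
    field_simp
    linear_combination -hbal'
  have hmin : 0 ≤ min 1 K := by positivity
  have hbern := rpow_one_add_le_one_add_mul_self (s := (n : ℝ)) (by linarith) hmin
    (min_le_left 1 K)
  have hmain : min 1 K * Real.log n ≤ Real.log (1 + K * n) := by
    rw [← Real.log_rpow (by linarith)]
    refine Real.log_le_log (by positivity) ?_
    calc (n : ℝ) ^ min 1 K ≤ (1 + n) ^ min 1 K :=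
          Real.rpow_le_rpow (by linarith) (by linarith) hmin
      _ ≤ 1 + min 1 K * n := hbern
      _ ≤ 1 + K * n := by gcongr; exact min_le_right 1 K
  rw [girthBound, harg, Real.logb, div_mul_eq_mul_div, mul_div_assoc', mul_assoc]
  gcongr

end GreedyTanner

theorem theorem2 (p q : ℕ) (hp : 0 < p) (hpq : p < q) (d : ℝ) (hd : 0 < d)
    (a b : ℕ) (ha : (a : ℝ) = p * d) (hb : (b : ℝ) = q * d) :
    (∀ m n : ℕ, GreedyTanner.Admissible p q d m n →
      GreedyTanner.NeverStuck n m (n * a) ∧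
      ∀ E : Finset (Fin n × Fin m), GreedyTanner.Reaches (n * a) E →
        ((2 * Real.logb (p * q * d ^ 2)
            (1 + m * (p * q * d ^ 2 - 1) / (2 * (p * d + 1))) : ℝ) : EReal)
          ≤ GreedyTanner.girth E) ∧
    (∃ c : ℝ, 0 < c ∧ ∀ m n : ℕ, GreedyTanner.Admissible p q d m n →
      ∀ E : Finset (Fin n × Fin m), GreedyTanner.Reaches (n * a) E →
        ((c * Real.log n : ℝ) : EReal) ≤ GreedyTanner.girth E) := by
  have hp' : (0 : ℝ) < p := by exact_mod_cast hp
  have hpq' : (p : ℝ) < q := by exact_mod_cast hpq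
  have ha0 : 0 < a := by
    have : (0 : ℝ) < a := by rw [ha]; positivity
    exact_mod_cast this
  have hab : a < b := by
    have : (a : ℝ) < b := by rw [ha, hb]; gcongr
    exact_mod_cast this
  have hab2 : 2 ≤ a * b := by nlinarith
  have hbal : ∀ m n : ℕ, GreedyTanner.Admissible p q d m n → n * a = m * b := by
    intro m n h
    have h1 : (n : ℝ) * p = m * q := by exact_mod_cast h.balance
    have h2 : (n : ℝ) * a = m * b := by rw [ha, hb]; linear_combination d * h1
    exact_mod_cast h2
  have hsize : ∀ m n : ℕ, GreedyTanner.Admissible p q d m n → 3 * (a + b) ≤ m + 3 := by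
    intro m n h
    have h1 := h.d_le
    rw [le_div_iff₀ (by positivity)] at h1
    have h2 : (3 : ℝ) * (a + b) ≤ m + 3 := by rw [ha, hb]; linarith
    exact_mod_cast h2
  have hbound : ∀ m : ℕ, 2 * Real.logb (p * q * d ^ 2)
      (1 + m * (p * q * d ^ 2 - 1) / (2 * (p * d + 1))) = GreedyTanner.girthBound a b m := by
    intro m
    have : (p : ℝ) * q * d ^ 2 = a * b := by rw [ha, hb]; ring
    rw [GreedyTanner.girthBound, this, ← ha]
  obtain ⟨c, hc, hcl⟩ := GreedyTanner.mul_log_le_girthBound hab2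
  refine ⟨fun m n h => ⟨fun e he E hE => ?_, fun E hE => ?_⟩, c, hc, fun m n h E hE => ?_⟩
  · have hm := h.one_lt
    have hn := h.lt
    have hs := hsize m n h
    rcases Nat.even_or_odd (e + 1) with hev | hod
    · obtain ⟨E', hE'⟩ := GreedyTanner.exists_evenStep (b := b) (by omega) (by omega) hE hev
        (by rwa [← hbal m n h]) (by omega)
      exact ⟨E', Or.inr ⟨hev, hE'⟩⟩
    · obtain ⟨E', hE'⟩ := GreedyTanner.exists_oddStep (by omega) (by omega) hE hod he hab hs
      exact ⟨E', Or.inl ⟨hod, hE'⟩⟩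
  · rw [hbound]
    exact GreedyTanner.le_girth_of_forall_isCycle fun u w hw =>
      hE.girthBound_le_length hab.le hab2 (hbal m n h) le_rfl w hw
  · refine GreedyTanner.le_girth_of_forall_isCycle fun u w hw => ?_
    have hn := h.lt
    exact (hcl m n (by omega) (hbal m n h)).trans
      (hE.girthBound_le_length hab.le hab2 (hbal m n h) le_rfl w hw)
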